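/- All graphs are finite and simple. Let $G$ be a graph, and for a vertex $v$ let $E_G(v)$ be the set of edges of $G$ incident with $v$. An edge coloring of $G$ with $k$ colors (a map $\varphi : E(G)\to\{1,\dots,k\}$, not necessarily proper) is called conflict-free if for every edge $uv\in E(G)$ there is a color that appears on exactly one edge of $E_G(u)\cup E_G(v)$. The conflict-free chromatic index $\chi'_{CF}(G)$ is the least $k$ for which $G$ has a conflict-free edge coloring with $k$ colors. Let $\Delta(G)$ denote the maximum degree of $G$. Then every graph $G$ without isolated vertices satisfies $$\chi'_{CF}(G)\le 2\lceil\log_2\Delta(G)\rceil+1.$$ -/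

import Mathlib

namespace SimpleGraph

universe u

variable {V : Type u}

/-- The closed neighborhood `E_G[uv] = E_G(u) ∪ E_G(v)` of an edge `e = uv`: the union, over the
endpoints `v` of `e`, of the set of edges of `G` incident with `v`. -/
def closedEdgeNeighborhood (G : SimpleGraph V) (e : Sym2 V) : Set (Sym2 V) :=
  ⋃ v ∈ e, G.incidenceSet v

/-- The pair `e` is satisfied by the edge coloring `φ` of `G` if some color appears exactly once
on the closed neighborhood of `e`. The coloring need not be proper. -/
def EdgeSatisfied (G : SimpleGraph V) {C : Type*} (φ : G.edgeSet → C) (e : Sym2 V) : Prop :=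
  ∃ c : C, ∃! f : G.edgeSet, (f : Sym2 V) ∈ G.closedEdgeNeighborhood e ∧ φ f = c

/-- An edge coloring is conflict-free if it satisfies every edge of `G`. -/
def IsConflictFreeEdgeColoring (G : SimpleGraph V) {C : Type*} (φ : G.edgeSet → C) : Prop :=
  ∀ e ∈ G.edgeSet, G.EdgeSatisfied φ e

/-- `G` admits a conflict-free edge coloring with `k` colors. -/
def ConflictFreeEdgeColorable (G : SimpleGraph V) (k : ℕ) : Prop :=
  ∃ φ : G.edgeSet → Fin k, G.IsConflictFreeEdgeColoring φ

/-- The conflict-free chromatic index: the least `k` such that `G` has a conflict-free edge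
coloring with `k` colors (`⊤` if there were none, which does not happen for finite graphs). -/
noncomputable def conflictFreeChromaticIndex (G : SimpleGraph V) : ℕ∞ :=
  ⨅ k ∈ {k : ℕ | G.ConflictFreeEdgeColorable k}, (k : ℕ∞)

end SimpleGraph

/-! Leaving edges uncolored costs only one extra color in the end, and partial colorings of
edge-disjoint graphs combine by using disjoint palettes. A maximum cut splits the edges into a
bipartite graph, which needs two colors, and an uncut graph with all degrees at least halved.
Starting from degrees at most `2 ^ m` with `m ≥ 1`, after `m - 1` cuts the remaining degrees are at
most 2 and two last colors suffice: `2 * m` colors in all, plus one for the uncolored edges. Maximum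
degree at most 1 is treated apart. -/

namespace SimpleGraph

variable {V : Type*}

/-! ### Partial colorings and their unions -/

/-- A partial edge coloring with `k` colors exists such that every edge of `G` sees some color
exactly once in its closed neighborhood; uncolored edges are those sent to `none`. -/
def PartiallyConflictFreeColorable (G : SimpleGraph V) (k : ℕ) : Prop :=
  ∃ c : Sym2 V → Option (Fin k), ∀ e ∈ G.edgeSet, ∃ i : Fin k,
    ∃! f : Sym2 V, f ∈ G.closedEdgeNeighborhood e ∧ c f = some i

theorem mem_closedEdgeNeighborhood {G : SimpleGraph V} {e f : Sym2 V} :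
    f ∈ G.closedEdgeNeighborhood e ↔ f ∈ G.edgeSet ∧ ∃ v ∈ e, v ∈ f := by
  simp only [closedEdgeNeighborhood, Set.mem_iUnion, incidenceSet, Set.mem_ofPred_eq, exists_prop]
  constructor
  · rintro ⟨v, hv, hf, h⟩
    exact ⟨hf, v, hv, h⟩
  · rintro ⟨hf, v, hv, h⟩
    exact ⟨v, hv, hf, h⟩

/-- All uncolored edges share one new color. It never serves as a witness, so its repetitions are
harmless. -/
theorem PartiallyConflictFreeColorable.conflictFreeEdgeColorable {G : SimpleGraph V} {k : ℕ}
    (h : G.PartiallyConflictFreeColorable k) : G.ConflictFreeEdgeColorable (k + 1) := by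
  obtain ⟨c, hc⟩ := h
  refine ⟨fun f => (finSuccEquiv k).symm (c f), fun e he => ?_⟩
  obtain ⟨i, f, ⟨hf, hfi⟩, huniq⟩ := hc e he
  refine ⟨(finSuccEquiv k).symm (some i), ⟨f, (mem_closedEdgeNeighborhood.1 hf).1⟩,
    ⟨hf, by simp only [hfi]⟩, ?_⟩
  rintro ⟨g, hg⟩ ⟨hgm, hgi⟩
  exact Subtype.ext (huniq g ⟨hgm, (finSuccEquiv k).symm.injective hgi⟩)

/-- With disjoint palettes, a color witnessing an edge of `G` occurs only on edges of `G`, so edges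
added by `H` cannot spoil its uniqueness. -/
theorem PartiallyConflictFreeColorable.sup {G H K : SimpleGraph V} {k l : ℕ}
    (hG : G.PartiallyConflictFreeColorable k) (hH : H.PartiallyConflictFreeColorable l)
    (hK : G ⊔ H = K) (hd : Disjoint G.edgeSet H.edgeSet) :
    K.PartiallyConflictFreeColorable (k + l) := by
  classical
  subst hK
  obtain ⟨c, hc⟩ := hG
  obtain ⟨d, hd'⟩ := hH
  refine ⟨fun f => if f ∈ G.edgeSet then (c f).map (Fin.castAdd l)
    else if f ∈ H.edgeSet then (d f).map (Fin.natAdd k) else none, fun e he => ?_⟩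
  rw [edgeSet_sup] at he
  rcases he with he | he
  · obtain ⟨i, f, ⟨hf, hfi⟩, huniq⟩ := hc e he
    rw [mem_closedEdgeNeighborhood] at hf
    refine ⟨Fin.castAdd l i, f, ⟨?_, by simp [hf.1, hfi]⟩, ?_⟩
    · rw [mem_closedEdgeNeighborhood, edgeSet_sup]
      exact ⟨Or.inl hf.1, hf.2⟩
    · rintro g ⟨hg, hgi⟩
      rw [mem_closedEdgeNeighborhood] at hg
      by_cases hgG : g ∈ G.edgeSet
      · simp only [if_pos hgG, Option.map_eq_some_iff] at hgi
        obtain ⟨j, hj, hji⟩ := hgi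
        rw [Fin.castAdd_inj] at hji
        exact huniq g ⟨mem_closedEdgeNeighborhood.2 ⟨hgG, hg.2⟩, hji ▸ hj⟩
      · by_cases hgH : g ∈ H.edgeSet
        · simp only [if_neg hgG, if_pos hgH, Option.map_eq_some_iff] at hgi
          obtain ⟨j, -, hji⟩ := hgi
          have := congrArg Fin.val hji
          have := i.2
          simp at *
          omega
        · simp [hgG, hgH] at hgi
  · obtain ⟨i, f, ⟨hf, hfi⟩, huniq⟩ := hd' e he
    rw [mem_closedEdgeNeighborhood] at hf
    have hnot : ∀ g ∈ H.edgeSet, g ∉ G.edgeSet := fun g hg hg' => Set.disjoint_left.1 hd hg' hg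
    refine ⟨Fin.natAdd k i, f, ⟨?_, by simp [hf.1, hfi, hnot f hf.1]⟩, ?_⟩
    · rw [mem_closedEdgeNeighborhood, edgeSet_sup]
      exact ⟨Or.inr hf.1, hf.2⟩
    · rintro g ⟨hg, hgi⟩
      rw [mem_closedEdgeNeighborhood] at hg
      by_cases hgG : g ∈ G.edgeSet
      · simp only [if_pos hgG, Option.map_eq_some_iff] at hgi
        obtain ⟨j, -, hji⟩ := hgi
        have := congrArg Fin.val hji
        have := j.2
        simp at *
        omega
      · by_cases hgH : g ∈ H.edgeSet
        · simp only [if_neg hgG, if_pos hgH, Option.map_eq_some_iff] at hgi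
          obtain ⟨j, hj, hji⟩ := hgi
          rw [Fin.natAdd_inj] at hji
          exact huniq g ⟨mem_closedEdgeNeighborhood.2 ⟨hgH, hg.2⟩, hji ▸ hj⟩
        · simp [hgG, hgH] at hgi

/-! ### Bipartite graphs -/

/-- A finite bipartite graph needs two colors: a minimal set `D` dominating one side provides a
private neighbor for each of its vertices, and the private edges take the first color. -/
theorem partiallyConflictFreeColorable_two_of_bipartite [Finite V] {G : SimpleGraph V}
    (side : V → Bool) (hside : ∀ x y, G.Adj x y → side x ≠ side y) :
    G.PartiallyConflictFreeColorable 2 := by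
  classical
  let A : Set V := {a | side a = true ∧ ∃ b, G.Adj a b}
  let P : Set V → Prop := fun D => ∀ a ∈ A, ∃ b ∈ D, G.Adj a b
  have hne : {D : Set V | P D}.Nonempty := ⟨Set.univ, fun a ha => by
    obtain ⟨b, hb⟩ := ha.2
    exact ⟨b, trivial, hb⟩⟩
  obtain ⟨D, hD, hmin⟩ := (Set.toFinite {D : Set V | P D}).exists_minimal hne
  have hpriv : ∀ b ∈ D, ∃ a ∈ A, G.Adj a b ∧ ∀ b' ∈ D, G.Adj a b' → b' = b := by
    intro b hb
    by_contra! hcon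
    have hP : P (D \ {b}) := by
      intro a ha
      obtain ⟨b₁, hb₁, hab₁⟩ := hD a ha
      by_cases hbb : b₁ = b
      · subst hbb
        obtain ⟨b₂, hb₂, hab₂, hne₂⟩ := hcon a ha hab₁
        exact ⟨b₂, ⟨hb₂, hne₂⟩, hab₂⟩
      · exact ⟨b₁, ⟨hb₁, hbb⟩, hab₁⟩
    exact (hmin hP Set.sdiff_subset hb).2 rfl
  choose! p hpA hpadj hpuniq using hpriv
  choose! q hqD hqadj using hD
  have hDs : ∀ b ∈ D, side b = false := fun b hb => by
    have h1 := hside _ _ (hpadj b hb)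
    have h2 := (hpA b hb).1
    grind
  have hqp : ∀ b ∈ D, q (p b) = b := fun b hb =>
    hpuniq b hb _ (hqD _ (hpA b hb)) (hqadj _ (hpA b hb))
  let c : Sym2 V → Option (Fin 2) := fun e =>
    if ∃ b ∈ D, e = s(p b, b) then some 0
    else if ∃ a ∈ A, e = s(a, q a) then some 1 else none
  have hc0 : ∀ e, c e = some 0 ↔ ∃ b ∈ D, e = s(p b, b) := by
    intro e
    simp only [c]
    split_ifs <;> simp_all
  have hc1 : ∀ e, c e = some 1 ↔ (¬ ∃ b ∈ D, e = s(p b, b)) ∧ ∃ a ∈ A, e = s(a, q a) := by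
    intro e
    simp only [c]
    split_ifs <;> simp_all
  have key : ∀ a b, G.Adj a b → side a = true → ∃ i : Fin 2,
      ∃! f : Sym2 V, f ∈ G.closedEdgeNeighborhood s(a, b) ∧ c f = some i := by
    intro a b hab ha
    have haA : a ∈ A := ⟨ha, b, hab⟩
    have hb : side b = false := by
      have := hside _ _ hab
      grind
    have hnot : ∀ b' ∈ D, b ≠ p b' ∧ a ≠ b' := fun b' hb' => by
      constructor
      · rintro rfl
        have := (hpA b' hb').1
        simp_all
      · rintro rfl
        have := hDs _ hb'
        simp_all
    -- A second private edge meeting `s(a, b)` would have to meet it at `a`, but a private vertex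
    -- has only one neighbor in `D`.
    by_cases hbD : b ∈ D
    · refine ⟨0, s(p b, b), ⟨mem_closedEdgeNeighborhood.2 ⟨hpadj b hbD, b, by simp, by simp⟩,
        (hc0 _).2 ⟨b, hbD, rfl⟩⟩, ?_⟩
      rintro g ⟨hg, hgc⟩
      obtain ⟨b', hb', rfl⟩ := (hc0 g).1 hgc
      obtain ⟨-, v, hv, hvg⟩ := mem_closedEdgeNeighborhood.1 hg
      have hn := hnot b' hb'
      suffices b' = b by rw [this]
      rw [Sym2.mem_iff] at hv hvg
      have := hpuniq b' hb' b hbD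
      grind
    -- As `b ∉ D`, no colored edge ends at `b`, so only colored edges at `a` matter. The edge `s(a,
    -- q a)` has color 0 or 1 according to whether `a` is the private neighbor chosen for `q a`.
    · by_cases hpa : p (q a) = a
      · refine ⟨0, s(a, q a), ⟨mem_closedEdgeNeighborhood.2 ⟨hqadj a haA, a, by simp, by simp⟩,
          (hc0 _).2 ⟨q a, hqD a haA, by rw [hpa]⟩⟩, ?_⟩
        rintro g ⟨hg, hgc⟩
        obtain ⟨b', hb', rfl⟩ := (hc0 g).1 hgc
        obtain ⟨-, v, hv, hvg⟩ := mem_closedEdgeNeighborhood.1 hg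
        have hn := hnot b' hb'
        have hq := hqp b' hb'
        suffices p b' = a by rw [← this, hq]
        rw [Sym2.mem_iff] at hv hvg
        grind
      · refine ⟨1, s(a, q a), ⟨mem_closedEdgeNeighborhood.2 ⟨hqadj a haA, a, by simp, by simp⟩,
          (hc1 _).2 ⟨?_, a, haA, rfl⟩⟩, ?_⟩
        · rintro ⟨b', hb', h⟩
          have hn := hnot b' hb'
          have hq := hqp b' hb'
          rw [Sym2.eq_iff] at h
          grind
        · rintro g ⟨hg, hgc⟩
          obtain ⟨-, a', ha', rfl⟩ := (hc1 g).1 hgc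
          obtain ⟨-, v, hv, hvg⟩ := mem_closedEdgeNeighborhood.1 hg
          have hn := hnot (q a') (hqD a' ha')
          have hqD' := hqD a' ha'
          have hs := ha'.1
          suffices a' = a by rw [this]
          rw [Sym2.mem_iff] at hv hvg
          grind
  refine ⟨c, fun e he => ?_⟩
  induction e using Sym2.ind with
  | _ x y =>
    rw [mem_edgeSet] at he
    by_cases hx : side x = true
    · exact key x y he hx
    · rw [Sym2.eq_swap]
      refine key y x he.symm ?_
      have := hside _ _ he
      grind

/-! ### Closed neighborhoods of at most three edges -/

/-- If all closed neighborhoods of edges have at most three elements, two colors suffice: the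
first is given to a maximal induced matching `S`, the second to a maximal matching among
the edges that do not see `S`. -/
theorem partiallyConflictFreeColorable_two_of_ncard_le_three [Finite V] {G : SimpleGraph V}
    (h3 : ∀ e ∈ G.edgeSet, (G.closedEdgeNeighborhood e).ncard ≤ 3) :
    G.PartiallyConflictFreeColorable 2 := by
  classical
  let N := G.closedEdgeNeighborhood
  have hNE : ∀ {e f}, f ∈ N e → f ∈ G.edgeSet := fun h => (mem_closedEdgeNeighborhood.1 h).1
  have hself : ∀ e ∈ G.edgeSet, e ∈ N e := fun e he =>
    mem_closedEdgeNeighborhood.2 ⟨he, e.out.1, Sym2.out_fst_mem e, Sym2.out_fst_mem e⟩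
  have hsymm : ∀ {e f}, e ∈ G.edgeSet → f ∈ N e → e ∈ N f := fun he h => by
    obtain ⟨-, v, hv, hv'⟩ := mem_closedEdgeNeighborhood.1 h
    exact mem_closedEdgeNeighborhood.2 ⟨he, v, hv', hv⟩
  let P : Set (Sym2 V) → Prop := fun S => S ⊆ G.edgeSet ∧ ∀ e ∈ G.edgeSet, (N e ∩ S).Subsingleton
  obtain ⟨S, ⟨hSE, hS⟩, hSmax⟩ := (Set.toFinite {S | P S}).exists_maximal
    ⟨∅, Set.empty_subset _, fun e _ => by simp⟩
  let U : Set (Sym2 V) := {e ∈ G.edgeSet | N e ∩ S = ∅}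
  -- Otherwise every edge seeing `x` would see nothing of `S`, and `x` could be added to `S`.
  have hU : ∀ x ∈ U, ∃ y ∈ N x, y ≠ x ∧ y ∉ U := by
    intro x hx
    by_contra! hcon
    have hP : P (insert x S) := by
      refine ⟨Set.insert_subset hx.1 hSE, fun e he => ?_⟩
      by_cases hxe : x ∈ N e
      · have heU : e ∈ U := by
          by_cases hex : e = x
          · exact hex ▸ hx
          · exact hcon e (hsymm he hxe) hex
        have h0 := heU.2
        rintro a ⟨haN, rfl | haS⟩ b ⟨hbN, rfl | hbS⟩
        · rfl
        · exact absurd (show b ∈ N e ∩ S from ⟨hbN, hbS⟩) (by simp [h0])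
        · exact absurd (show a ∈ N e ∩ S from ⟨haN, haS⟩) (by simp [h0])
        · exact absurd (show a ∈ N e ∩ S from ⟨haN, haS⟩) (by simp [h0])
      · rintro a ⟨haN, rfl | haS⟩ b ⟨hbN, rfl | hbS⟩
        · rfl
        · exact absurd haN hxe
        · exact absurd hbN hxe
        · exact hS e he ⟨haN, haS⟩ ⟨hbN, hbS⟩
    have hxS : x ∈ S := hSmax hP (Set.subset_insert _ _) (Set.mem_insert _ _)
    exact absurd (show x ∈ N x ∩ S from ⟨hself x hx.1, hxS⟩) (by simp [hx.2])
  -- Of the at most three edges in `N x`, two are `x` and some `y ∉ U`; this leaves room for only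
  -- one other member of `U`.
  have hU2 : ∀ x ∈ U, ∀ a ∈ N x, ∀ b ∈ N x, a ∈ U → b ∈ U → a ≠ x → b ≠ x → a = b := by
    intro x hx a ha b hb haU hbU hax hbx
    by_contra hab
    obtain ⟨y, hy, hyx, hyU⟩ := hU x hx
    have hsub : (({x, y, a, b} : Finset (Sym2 V)) : Set (Sym2 V)) ⊆ N x := by
      intro z hz
      simp only [Finset.coe_insert, Finset.coe_singleton, Set.mem_insert_iff,
        Set.mem_singleton_iff] at hz
      rcases hz with rfl | rfl | rfl | rfl
      exacts [hself _ hx.1, hy, ha, hb]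
    have hle := Set.ncard_le_ncard hsub (Set.toFinite _)
    have hya : y ≠ a := fun h => hyU (h ▸ haU)
    have hyb : y ≠ b := fun h => hyU (h ▸ hbU)
    rw [Set.ncard_coe_finset, Finset.card_insert_of_notMem (by simp [hyx.symm, hax.symm, hbx.symm]),
      Finset.card_insert_of_notMem (by simp [hya, hyb]), Finset.card_pair hab] at hle
    have := h3 x hx.1
    change (N x).ncard ≤ 3 at this
    omega
  let Q : Set (Sym2 V) → Prop := fun T => T ⊆ U ∧ ∀ a ∈ T, ∀ b ∈ T, a ∈ N b → a = b
  obtain ⟨T, ⟨hTU, hT⟩, hTmax⟩ := (Set.toFinite {T | Q T}).exists_maximal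
    ⟨∅, Set.empty_subset _, fun a ha => by simp at ha⟩
  have hTS : ∀ t ∈ T, t ∉ S := fun t ht hts =>
    absurd (show t ∈ N t ∩ S from ⟨hself t (hTU ht).1, hts⟩) (by simp [(hTU ht).2])
  have hdom : ∀ x ∈ U, ∃ t ∈ T, t ∈ N x := by
    intro x hx
    by_contra! hcon
    have hQ : Q (insert x T) := by
      refine ⟨Set.insert_subset hx hTU, ?_⟩
      rintro a (rfl | ha) b (rfl | hb) hab
      · rfl
      · exact absurd (hsymm (hTU hb).1 hab) (hcon b hb)
      · exact absurd hab (hcon a ha)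
      · exact hT a ha b hb hab
    have hxT : x ∈ T := hTmax hQ (Set.subset_insert _ _) (Set.mem_insert _ _)
    exact hcon x hxT (hself x hx.1)
  refine ⟨fun f => if f ∈ S then some 0 else if f ∈ T then some 1 else none, fun e he => ?_⟩
  by_cases heU : e ∈ U
  · obtain ⟨t, ht, hte⟩ := hdom e heU
    refine ⟨1, t, ⟨hte, by simp [hTS t ht, ht]⟩, ?_⟩
    rintro g ⟨hg, hgc⟩
    have hgT : g ∈ T := by
      by_contra hgT
      by_cases hgS : g ∈ S <;> simp [hgS, hgT] at hgc
    by_cases hge : g = e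
    · exact hge ▸ (hT t ht e (hge ▸ hgT) hte).symm
    by_cases hte' : t = e
    · exact hte' ▸ hT g hgT e (hte' ▸ ht) hg
    exact hU2 e heU g hg t hte (hTU hgT) (hTU ht) hge hte'
  · have hne : (N e ∩ S).Nonempty := by
      rw [Set.nonempty_iff_ne_empty]
      exact fun h => heU ⟨he, h⟩
    obtain ⟨s, hs⟩ := hne
    refine ⟨0, s, ⟨hs.1, by simp [hs.2]⟩, ?_⟩
    rintro g ⟨hg, hgc⟩
    have hgS : g ∈ S := by
      by_contra hgS
      by_cases hgT : g ∈ T <;> simp [hgS, hgT] at hgc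
    exact hS e he ⟨hg, hgS⟩ hs

/-- The edge itself is counted at both ends, hence the `- 1`. The bound is 3 for `d = 2` and 1 for
`d = 1`. -/
theorem ncard_closedEdgeNeighborhood_le [Fintype V] {G : SimpleGraph V} [DecidableRel G.Adj]
    {d : ℕ} (hd : ∀ v, G.degree v ≤ d) (e : Sym2 V) (he : e ∈ G.edgeSet) :
    (G.closedEdgeNeighborhood e).ncard ≤ 2 * d - 1 := by
  classical
  induction e using Sym2.ind with
  | _ x y =>
    have hsub : G.closedEdgeNeighborhood s(x, y) =
        ((G.incidenceFinset x ∪ G.incidenceFinset y : Finset (Sym2 V)) : Set (Sym2 V)) := by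
      ext f
      simp [closedEdgeNeighborhood]
    rw [hsub, Set.ncard_coe_finset]
    have hinter : 0 < (G.incidenceFinset x ∩ G.incidenceFinset y).card :=
      Finset.card_pos.2 ⟨s(x, y), by simp [incidenceSet, G.mem_edgeSet.1 he]⟩
    have hsum := Finset.card_union_add_card_inter (G.incidenceFinset x) (G.incidenceFinset y)
    rw [card_incidenceFinset_eq_degree, card_incidenceFinset_eq_degree] at hsum
    have := hd x
    have := hd y
    omega

/-! ### Halving degrees by a maximum cut -/

/-- The subgraph of edges whose endpoints have the same label. -/
def monochromatic {C : Type*} (G : SimpleGraph V) (f : V → C) : SimpleGraph V where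
  Adj x y := G.Adj x y ∧ f x = f y
  symm := ⟨fun _ _ h => ⟨h.1.symm, h.2.symm⟩⟩
  loopless := ⟨fun _ h => h.1.ne rfl⟩

theorem monochromatic_adj {C : Type*} {G : SimpleGraph V} {f : V → C} {x y : V} :
    (G.monochromatic f).Adj x y ↔ G.Adj x y ∧ f x = f y := Iff.rfl

/-- The subgraph of edges whose endpoints have different labels. -/
def bichromatic {C : Type*} (G : SimpleGraph V) (f : V → C) : SimpleGraph V where
  Adj x y := G.Adj x y ∧ f x ≠ f y
  symm := ⟨fun _ _ h => ⟨h.1.symm, h.2.symm⟩⟩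
  loopless := ⟨fun _ h => h.1.ne rfl⟩

open Classical in
/-- A maximum cut leaves at most half of the edges at each vertex uncut. -/
theorem exists_two_mul_degree_monochromatic_le [Fintype V] (G : SimpleGraph V) :
    ∃ f : V → Bool, ∀ v, 2 * (G.monochromatic f).degree v ≤ G.degree v := by
  obtain ⟨f, -, hf⟩ := Finset.exists_min_image (Finset.univ : Finset (V → Bool))
    (fun f => (G.monochromatic f).edgeFinset.card) Finset.univ_nonempty
  refine ⟨f, fun v => ?_⟩
  -- Moving `v` across the cut exchanges the cut and uncut edges at `v` and affects no others, so
  -- minimality bounds the uncut degree of `v` by its cut degree.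
  let f' := Function.update f v (!f v)
  have hmin := hf f' (Finset.mem_univ _)
  have hdel : (G.monochromatic f).deleteIncidenceSet v =
      (G.monochromatic f').deleteIncidenceSet v := by
    ext x y
    simp only [deleteIncidenceSet_adj, monochromatic_adj, f']
    constructor
    · rintro ⟨h, hx, hy⟩
      exact ⟨by simpa [hx, hy] using h, hx, hy⟩
    · rintro ⟨h, hx, hy⟩
      exact ⟨by simpa [hx, hy] using h, hx, hy⟩
  have h1 := (G.monochromatic f).card_edgeFinset_deleteIncidenceSet v
  have h2 := (G.monochromatic f').card_edgeFinset_deleteIncidenceSet v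
  have h3 : ((G.monochromatic f).deleteIncidenceSet v).edgeFinset.card =
      ((G.monochromatic f').deleteIncidenceSet v).edgeFinset.card := by
    congr 1
    ext e
    simp only [mem_edgeFinset, hdel]
  have h4 := (G.monochromatic f).degree_le_card_edgeFinset v
  have h5 := (G.monochromatic f').degree_le_card_edgeFinset v
  have h6 : (G.monochromatic f).degree v + (G.monochromatic f').degree v = G.degree v := by
    simp only [← card_neighborFinset_eq_degree]
    rw [← Finset.card_union_of_disjoint]
    · congr 1
      ext w
      simp only [Finset.mem_union, mem_neighborFinset, monochromatic_adj, f']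
      by_cases hw : w = v
      · simp [hw]
      · simp only [Function.update_self, Function.update_of_ne hw]
        cases f v <;> cases f w <;> simp
    · rw [Finset.disjoint_left]
      intro w hw hw'
      simp only [mem_neighborFinset, monochromatic_adj, f'] at hw hw'
      have hne : w ≠ v := hw.1.ne.symm
      simp only [Function.update_self, Function.update_of_ne hne] at hw'
      grind
  omega

open Classical in
-- The exponent starts at 1 because a single edge already defeats a palette of zero colors.
theorem partiallyConflictFreeColorable_of_degree_le_two_pow [Fintype V] (m : ℕ) :
    ∀ G : SimpleGraph V, (∀ v, G.degree v ≤ 2 ^ (m + 1)) →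
      G.PartiallyConflictFreeColorable (2 * (m + 1)) := by
  induction m with
  | zero =>
    intro G hG
    exact partiallyConflictFreeColorable_two_of_ncard_le_three
      (ncard_closedEdgeNeighborhood_le (d := 2) hG)
  | succ m ih =>
    intro G hG
    obtain ⟨f, hf⟩ := G.exists_two_mul_degree_monochromatic_le
    have h1 := ih (G.monochromatic f) fun v => by
      have := hf v
      have := hG v
      rw [pow_succ] at this
      omega
    have h2 : (G.bichromatic f).PartiallyConflictFreeColorable 2 :=
      partiallyConflictFreeColorable_two_of_bipartite f fun _ _ h => h.2
    refine h1.sup h2 ?_ ?_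
    · ext x y
      simp only [sup_adj, monochromatic, bichromatic]
      tauto
    · rw [Set.disjoint_left]
      intro e
      induction e using Sym2.ind with
      | _ x y => exact fun h h' => h'.2 h.2

theorem conflictFreeEdgeColorable_one_of_degree_le_one [Fintype V] {G : SimpleGraph V}
    [DecidableRel G.Adj] (hG : ∀ v, G.degree v ≤ 1) : G.ConflictFreeEdgeColorable 1 := by
  refine ⟨fun _ => 0, fun e he => ⟨0, ⟨e, he⟩, ⟨?_, rfl⟩, ?_⟩⟩
  · exact mem_closedEdgeNeighborhood.2 ⟨he, e.out.1, Sym2.out_fst_mem e, Sym2.out_fst_mem e⟩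
  · rintro ⟨f, hf⟩ ⟨hfe, -⟩
    have hself := mem_closedEdgeNeighborhood.2
      ⟨he, e.out.1, Sym2.out_fst_mem e, Sym2.out_fst_mem e⟩
    exact Subtype.ext ((Set.ncard_le_one (Set.toFinite _)).1
      (ncard_closedEdgeNeighborhood_le hG e he) f hfe e hself)

theorem ConflictFreeEdgeColorable.conflictFreeChromaticIndex_le {G : SimpleGraph V} {k : ℕ}
    (h : G.ConflictFreeEdgeColorable k) : G.conflictFreeChromaticIndex ≤ k :=
  iInf₂_le k h

end SimpleGraph

theorem corollary1p5 {V : Type*} [Fintype V] (G : SimpleGraph V) [DecidableRel G.Adj]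
    (hG : ∀ v : V, ¬ G.IsIsolated v) :
    G.conflictFreeChromaticIndex ≤
      ((2 * ⌈Real.logb 2 (G.maxDegree : ℝ)⌉₊ + 1 : ℕ) : ℕ∞) := by
  classical
  apply SimpleGraph.ConflictFreeEdgeColorable.conflictFreeChromaticIndex_le
  have hmax : G.maxDegree ≤ 2 ^ ⌈Real.logb 2 (G.maxDegree : ℝ)⌉₊ := by
    -- Passing from logarithm to power needs a positive argument.
    rcases Nat.eq_zero_or_pos G.maxDegree with h0 | hpos
    · simp [h0]
    · have h := (Real.logb_le_iff_le_rpow (b := 2) one_lt_two (Nat.cast_pos.2 hpos)).1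
        (Nat.le_ceil (Real.logb 2 (G.maxDegree : ℝ)))
      rw [Real.rpow_natCast] at h
      exact_mod_cast h
  have hdeg : ∀ v, G.degree v ≤ 2 ^ ⌈Real.logb 2 (G.maxDegree : ℝ)⌉₊ := fun v =>
    (G.degree_le_maxDegree v).trans hmax
  generalize ⌈Real.logb 2 (G.maxDegree : ℝ)⌉₊ = m at hdeg
  cases m with
  | zero => exact SimpleGraph.conflictFreeEdgeColorable_one_of_degree_le_one hdeg
  | succ m =>
    exact (SimpleGraph.partiallyConflictFreeColorable_of_degree_le_two_pow m G
      fun v => by convert hdeg v).conflictFreeEdgeColorable
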